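/- Let $X$ be a compact Hausdorff space and let $C(X)$ be the vector lattice of continuous functions $f:X\to\mathbb{R}$ with the pointwise order. Let $I:C(X)\to\mathbb{R}$ be a functional with $I(1)=1$ that is monotone ($f\le g$ implies $I(f)\le I(g)$) and comonotonically additive, that is, $I(f+g)=I(f)+I(g)$ for all $f,g\in C(X)$ such that $(f(s)-f(t))(g(s)-g(t))\ge 0$ for all $s,t\in X$. Let $\Sigma_{up}^{-}(X)$ be the lattice of all sets $\{x\in X: f(x)>t\}$ with $f\in C(X)$ and $t\in\mathbb{R}$. A capacity on $\Sigma_{up}^{-}(X)$ is a function $\mu:\Sigma_{up}^{-}(X)\to[0,\infty)$ with $\mu(\emptyset)=0$ and $\mu(A)\le\mu(B)$ whenever $A\subset B$; it is normalized if $\mu(X)=1$, and lower continuous if $\lim_{n\to\infty}\mu(A_n)=\mu\left(\bigcup_{n}A_n\right)$ for every nondecreasing sequence $(A_n)_n$ in $\Sigma_{up}^{-}(X)$ whose union belongs to $\Sigma_{up}^{-}(X)$. Then $I$ is lower continuous: if $(f_n)_n$ is a nondecreasing sequence in $C(X)$ that converges pointwise to some $f\in C(X)$, then $\lim_{n\to\infty}I(f_n)=I(f)$.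 Moreover, there exists a unique lower continuous normalized capacity $\mu:\Sigma_{up}^{-}(X)\to[0,1]$ such that \[ I(f)=\int_{0}^{+\infty}\mu\left(\{x\in X:f(x)>t\}\right)\,\mathrm{d}t+\int_{-\infty}^{0}\left[\mu\left(\{x\in X:f(x)>t\}\right)-1\right]\mathrm{d}t \] for all $f\in C(X)$, both integrals being finite. Finally, if $I$ is submodular, that is, $I(\sup\{f,g\})+I(\inf\{f,g\})\le I(f)+I(g)$ for all $f,g\in C(X)$, then $\mu$ is submodular, that is, $\mu(A\cup B)+\mu(A\cap B)\le\mu(A)+\mu(B)$ for all $A,B\in\Sigma_{up}^{-}(X)$. -/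

import Mathlib

open MeasureTheory Filter Topology

namespace ChoquetRep

/-- A lattice of subsets of `X`: it contains `∅` and `X` and is closed under finite unions and
intersections. -/
structure SetLattice (X : Type*) where
  carrier : Set (Set X)
  empty_mem : ∅ ∈ carrier
  univ_mem : Set.univ ∈ carrier
  union_mem : ∀ A ∈ carrier, ∀ B ∈ carrier, A ∪ B ∈ carrier
  inter_mem : ∀ A ∈ carrier, ∀ B ∈ carrier, A ∩ B ∈ carrier

/-- A capacity on a lattice of sets: a set function with values in `[0, ∞)`, vanishing at `∅` and
monotone under inclusion. It is defined on the members of the lattice only, so that equality of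
capacities is equality on the lattice. -/
@[ext]
structure Capacity {X : Type*} (L : SetLattice X) where
  toFun : {A : Set X // A ∈ L.carrier} → ℝ
  nonneg : ∀ A, 0 ≤ toFun A
  empty : toFun ⟨∅, L.empty_mem⟩ = 0
  mono : ∀ A B : {A : Set X // A ∈ L.carrier}, (A : Set X) ⊆ (B : Set X) → toFun A ≤ toFun B

namespace Capacity

variable {X : Type*} {L : SetLattice X}

def IsNormalized (μ : Capacity L) : Prop :=
  μ.toFun ⟨Set.univ, L.univ_mem⟩ = 1

def IsSubmodular (μ : Capacity L) : Prop :=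
  ∀ A B : {A : Set X // A ∈ L.carrier},
    μ.toFun ⟨(A : Set X) ∪ B, L.union_mem A A.2 B B.2⟩
      + μ.toFun ⟨(A : Set X) ∩ B, L.inter_mem A A.2 B B.2⟩ ≤ μ.toFun A + μ.toFun B

/-- Continuity along nondecreasing sequences of members of the lattice whose union is a member. -/
def IsLowerContinuous (μ : Capacity L) : Prop :=
  ∀ A : ℕ → {A : Set X // A ∈ L.carrier},
    (∀ m n, m ≤ n → (A m : Set X) ⊆ (A n : Set X)) →
    ∀ h : (⋃ n, (A n : Set X)) ∈ L.carrier,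
      Tendsto (fun n => μ.toFun (A n)) atTop (𝓝 (μ.toFun ⟨⋃ n, (A n : Set X), h⟩))

end Capacity

/-- The lattice of upper contour open sets `{x | f x > t}`, with `f` continuous and `t` real. -/
def upperContourOpen (X : Type*) [TopologicalSpace X] : SetLattice X where
  carrier := {S | ∃ (f : C(X, ℝ)) (t : ℝ), S = {x | f x > t}}
  empty_mem := ⟨0, 0, by ext x; simp⟩
  univ_mem := ⟨0, -1, by ext x; simp⟩
  union_mem := by
    rintro _ ⟨f, s, rfl⟩ _ ⟨g, t, rfl⟩
    refine ⟨(f - ContinuousMap.const X s) ⊔ (g - ContinuousMap.const X t), 0, ?_⟩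
    ext x
    simp
  inter_mem := by
    rintro _ ⟨f, s, rfl⟩ _ ⟨g, t, rfl⟩
    refine ⟨(f - ContinuousMap.const X s) ⊓ (g - ContinuousMap.const X t), 0, ?_⟩
    ext x
    simp

section Functionals

variable {X : Type*} [TopologicalSpace X]

/-- The set `{x | f x > t}` as a member of the lattice of upper contour open sets. -/
def contour (f : C(X, ℝ)) (t : ℝ) : {A : Set X // A ∈ (upperContourOpen X).carrier} :=
  ⟨{x | f x > t}, f, t, rfl⟩

def Comonotone (f g : C(X, ℝ)) : Prop :=
  ∀ s t : X, (f s - f t) * (g s - g t) ≥ 0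

def ComonotoneAdditive (I : C(X, ℝ) → ℝ) : Prop :=
  ∀ f g : C(X, ℝ), Comonotone f g → I (f + g) = I f + I g

/-- Continuity along nondecreasing sequences of continuous functions that converge pointwise to a
continuous function. -/
def LowerContinuousFunctional (I : C(X, ℝ) → ℝ) : Prop :=
  ∀ (u : ℕ → C(X, ℝ)) (f : C(X, ℝ)), Monotone u →
    (∀ x, Tendsto (fun n => u n x) atTop (𝓝 (f x))) →
    Tendsto (fun n => I (u n)) atTop (𝓝 (I f))

def SubmodularFunctional (I : C(X, ℝ) → ℝ) : Prop :=
  ∀ f g : C(X, ℝ), I (f ⊔ g) + I (f ⊓ g) ≤ I f + I g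

/-- `I` is the Choquet integral with respect to the normalized capacity `μ`: for every continuous
`f` both integrals are finite and `I f` is their sum. The integrands are monotone functions of
`t` of constant sign (for normalized `μ`), so these Lebesgue integrals are the improper Riemann
integrals. -/
def Represents (μ : Capacity (upperContourOpen X)) (I : C(X, ℝ) → ℝ) : Prop :=
  ∀ f : C(X, ℝ),
    IntegrableOn (fun t : ℝ => μ.toFun (contour f t)) (Set.Ioi 0) ∧
    IntegrableOn (fun t : ℝ => μ.toFun (contour f t) - 1) (Set.Iic 0) ∧
    I f = (∫ t in Set.Ioi (0 : ℝ), μ.toFun (contour f t))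
      + ∫ t in Set.Iic (0 : ℝ), (μ.toFun (contour f t) - 1)

end Functionals

end ChoquetRep

namespace ChoquetRep

open ContinuousMap

/-! The capacity is μ(A) = sup of I(g) over continuous g with 0 ≤ g ≤ 1_A. For s < t, the function f
∧ t is the sum of f ∧ s and (t - s) times a slice h of f with values in [0, 1]. Both are
nondecreasing functions of f, so comonotone additivity gives I(f ∧ t) - I(f ∧ s) = (t - s) I(h)
(`map_inf_const_sub`). The slice vanishes off {f > s} and dominates every g admissible for {f > t},
so I(h) lies between μ(f > t) and μ(f > s). Hence t ↦ I(f ∧ t) is a primitive of t ↦ μ(f > t)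
(`sub_eq_integral_of_antitone`), which is the Choquet formula.

Conversely, the formula evaluated at ever steeper slices recovers any representing, normalized,
lower continuous capacity as a limit of values of I (`tendsto_map_clip`). This yields uniqueness,
and also submodularity, since slicing commutes with lattice operations. -/

/-! ### Real functions of one variable -/

/-- An additive monotone function on `[0, ∞)` is linear. -/
theorem eq_mul_of_additive_monotone {g : ℝ → ℝ}
    (hadd : ∀ a b, 0 ≤ a → 0 ≤ b → g (a + b) = g a + g b)
    (hmono : ∀ a b, 0 ≤ a → a ≤ b → g a ≤ g b) {c : ℝ} (hc : 0 ≤ c) : g c = c * g 1 := by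
  have h0 : g 0 = 0 := by
    have := hadd 0 0 le_rfl le_rfl
    rw [add_zero] at this
    linarith
  have hnat : ∀ x, 0 ≤ x → ∀ n : ℕ, g (n * x) = n * g x := by
    intro x hx n
    induction n with
    | zero => simp [h0]
    | succ k ih =>
      have := hadd (k * x) x (by positivity) hx
      push_cast
      rw [add_mul, one_mul, this, ih]
      ring
  -- With k the integer part of nc, both n g(c) = g(nc) and nc g(1) lie between k g(1) and (k + 1)
  -- g(1).
  have key : ∀ n : ℕ, n * |g c - c * g 1| ≤ g 1 := by
    intro n
    have hnc : (0 : ℝ) ≤ n * c := by positivity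
    have h1 := Nat.floor_le hnc
    have h2 := (Nat.lt_floor_add_one ((n : ℝ) * c)).le
    set k := ⌊(n : ℝ) * c⌋₊
    have a1 := hmono _ _ (Nat.cast_nonneg k) h1
    have a2 := hmono _ _ hnc h2
    have e1 := hnat 1 zero_le_one k
    have e2 := hnat 1 zero_le_one (k + 1)
    rw [mul_one] at e1 e2
    push_cast at e2
    rw [e1, hnat c hc n] at a1
    rw [e2, hnat c hc n] at a2
    have p : 0 ≤ g 1 := h0 ▸ hmono 0 1 le_rfl zero_le_one
    have b1 := mul_le_mul_of_nonneg_right h1 p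
    have b2 := mul_le_mul_of_nonneg_right h2 p
    rw [← Nat.abs_cast n, ← abs_mul, abs_le]
    constructor <;> nlinarith
  by_contra hne
  obtain ⟨n, hn⟩ := exists_nat_gt (g 1 / |g c - c * g 1|)
  rw [div_lt_iff₀ (abs_pos.2 (sub_ne_zero.2 hne))] at hn
  exact absurd (key n) (not_le.2 hn)

/-- A function whose increments are controlled by an antitone function is its primitive. -/
theorem sub_eq_integral_of_antitone {F m : ℝ → ℝ} (hm : Antitone m)
    (hlow : ∀ s t, s < t → (t - s) * m t ≤ F t - F s)
    (hup : ∀ s t, s < t → F t - F s ≤ (t - s) * m s) {a b : ℝ} (hab : a ≤ b) :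
    F b - F a = ∫ t in a..b, m t := by
  have hint : ∀ s t, IntervalIntegrable m volume s t := fun s t => hm.intervalIntegrable
  set G : ℝ → ℝ := fun t => F t - ∫ x in a..t, m x with hG
  have step : ∀ s t, s ≤ t → |G t - G s| ≤ (t - s) * (m s - m t) := by
    intro s t hst
    rcases hst.eq_or_lt with rfl | hlt
    · simp
    have e : G t - G s = (F t - F s) - ∫ x in s..t, m x := by
      simp only [hG]
      rw [← intervalIntegral.integral_add_adjacent_intervals (hint a s) (hint s t)]
      ring
    have i1 : (t - s) * m t ≤ ∫ x in s..t, m x := by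
      have := intervalIntegral.integral_mono_on hst intervalIntegrable_const (hint s t)
        (f := fun _ => m t) fun x hx => hm hx.2
      simpa using this
    have i2 : ∫ x in s..t, m x ≤ (t - s) * m s := by
      have := intervalIntegral.integral_mono_on hst (hint s t) intervalIntegrable_const
        (g := fun _ => m s) fun x hx => hm hx.1
      simpa using this
    rw [e, abs_le]
    constructor <;> nlinarith [hlow s t hlt, hup s t hlt]
  -- Summing `step` over n + 1 equal pieces, the drops of `m` telescope and the common length
  -- supplies the factor 1/(n + 1).
  have bound : ∀ n : ℕ, |G b - G a| * (n + 1) ≤ (b - a) * (m a - m b) := by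
    intro n
    set d : ℝ := (b - a) / (n + 1) with hd
    have hn : (0 : ℝ) < n + 1 := by positivity
    have hd0 : 0 ≤ d := div_nonneg (sub_nonneg.2 hab) hn.le
    have hk : ∀ k : ℕ, |G (a + k * d) - G a| ≤ d * (m a - m (a + k * d)) := by
      intro k
      induction k with
      | zero => simp
      | succ k ih =>
        have h := step (a + k * d) (a + (k + 1 : ℕ) * d) (by push_cast; nlinarith)
        have h' : a + (k + 1 : ℕ) * d - (a + k * d) = d := by push_cast; ring
        rw [h'] at h
        have := abs_sub_le (G (a + (k + 1 : ℕ) * d)) (G (a + k * d)) (G a)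
        linarith
    have h := hk (n + 1)
    have e : a + (n + 1 : ℕ) * d = b := by
      rw [hd]; push_cast; field_simp; ring
    rw [e] at h
    calc |G b - G a| * (n + 1) ≤ d * (m a - m b) * (n + 1) := by gcongr
      _ = (b - a) * (m a - m b) := by rw [hd]; field_simp
  have hzero : G b - G a = 0 := by
    by_contra hne
    have hpos := abs_pos.2 hne
    obtain ⟨n, hn⟩ := exists_nat_gt ((b - a) * (m a - m b) / |G b - G a|)
    rw [div_lt_iff₀ hpos] at hn
    nlinarith [bound n]
  simp only [hG, intervalIntegral.integral_same] at hzero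
  linarith

/-! ### Slices of a function and comonotone additive functionals -/

section Functional

variable {X : Type*} [TopologicalSpace X]

/-- The truncation `min (max (c * (f - s)) 0) 1` of `f`. -/
noncomputable def clip (f : C(X, ℝ)) (s c : ℝ) : C(X, ℝ) :=
  ((c • (f - const X s)) ⊔ 0) ⊓ 1

theorem clip_apply (f : C(X, ℝ)) (s c : ℝ) (x : X) :
    clip f s c x = min (max (c * (f x - s)) 0) 1 := by
  simp [clip]

theorem clip_nonneg (f : C(X, ℝ)) (s c : ℝ) (x : X) : 0 ≤ clip f s c x := by
  rw [clip_apply]; exact le_min (le_max_right _ _) zero_le_one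

theorem clip_le_one (f : C(X, ℝ)) (s c : ℝ) (x : X) : clip f s c x ≤ 1 := by
  rw [clip_apply]; exact min_le_right _ _

theorem clip_sup (f g : C(X, ℝ)) {c : ℝ} (hc : 0 ≤ c) :
    clip (f ⊔ g) 0 c = clip f 0 c ⊔ clip g 0 c := by
  ext x
  rw [sup_apply, clip_apply, clip_apply, clip_apply, sup_apply]
  simp only [sub_zero, mul_max_of_nonneg _ _ hc]
  rw [← min_max_distrib_right]
  congr 1
  exact sup_sup_distrib_right _ _ _

theorem clip_inf (f g : C(X, ℝ)) {c : ℝ} (hc : 0 ≤ c) :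
    clip (f ⊓ g) 0 c = clip f 0 c ⊓ clip g 0 c := by
  ext x
  rw [inf_apply, clip_apply, clip_apply, clip_apply, inf_apply]
  simp only [sub_zero, mul_min_of_nonneg _ _ hc]
  rw [max_min_distrib_right]
  exact inf_inf_distrib_right _ _ _

theorem comonotone_of_monotone_comp (f u v : C(X, ℝ)) {φ ψ : ℝ → ℝ} (hφ : Monotone φ)
    (hψ : Monotone ψ) (hu : ∀ x, u x = φ (f x)) (hv : ∀ x, v x = ψ (f x)) : Comonotone u v := by
  intro s t
  rw [hu, hu, hv, hv]
  rcases le_total (f s) (f t) with h | h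
  · exact mul_nonneg_of_nonpos_of_nonpos (sub_nonpos.2 (hφ h)) (sub_nonpos.2 (hψ h))
  · exact mul_nonneg (sub_nonneg.2 (hφ h)) (sub_nonneg.2 (hψ h))

variable {I : C(X, ℝ) → ℝ}

theorem ComonotoneAdditive.map_zero (hadd : ComonotoneAdditive I) : I 0 = 0 := by
  have := hadd 0 0 (by intro s t; simp)
  rw [add_zero] at this
  linarith

/-- Nonnegative multiples of one function are comonotone, so c ↦ I(cf) is additive; it is monotone
because f ≥ 0. -/
theorem ComonotoneAdditive.map_smul (hadd : ComonotoneAdditive I) (hmono : Monotone I)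
    {f : C(X, ℝ)} (hf : 0 ≤ f) {c : ℝ} (hc : 0 ≤ c) : I (c • f) = c * I f := by
  have := eq_mul_of_additive_monotone (g := fun c => I (c • f)) ?_ ?_ hc
  · simpa using this
  · intro a b ha hb
    simp only [add_smul]
    exact hadd _ _ (comonotone_of_monotone_comp f _ _ (monotone_mul_left_of_nonneg ha)
      (monotone_mul_left_of_nonneg hb) (fun _ => rfl) fun _ => rfl)
  · intro a b _ hab
    refine hmono fun x => ?_
    exact mul_le_mul_of_nonneg_right hab (hf x)

theorem ComonotoneAdditive.map_const (hadd : ComonotoneAdditive I) (hmono : Monotone I)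
    (hone : I 1 = 1) (c : ℝ) : I (const X c) = c := by
  have hpos : ∀ c : ℝ, 0 ≤ c → I (const X c) = c := by
    intro c hc
    have h := hadd.map_smul hmono (f := 1) (fun x => zero_le_one) hc
    have e : c • (1 : C(X, ℝ)) = const X c := by ext x; simp
    rwa [e, hone, mul_one] at h
  rcases le_total 0 c with h | h
  · exact hpos c h
  · have h1 := hadd (const X c) (const X (-c)) (by intro s t; simp)
    have e : const X c + const X (-c) = 0 := by ext x; simp
    rw [e, hadd.map_zero, hpos (-c) (by linarith)] at h1
    linarith

theorem ComonotoneAdditive.map_add_const (hadd : ComonotoneAdditive I) (hmono : Monotone I)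
    (hone : I 1 = 1) (f : C(X, ℝ)) (c : ℝ) : I (f + const X c) = I f + c := by
  rw [hadd f (const X c) (by intro s t; simp), hadd.map_const hmono hone]

/-- By Dini's theorem the convergence is uniform, and monotonicity with translation by constants
makes `I` 1-Lipschitz for the uniform norm. -/
theorem ComonotoneAdditive.lowerContinuous [CompactSpace X] (hadd : ComonotoneAdditive I)
    (hmono : Monotone I) (hone : I 1 = 1) : LowerContinuousFunctional I := by
  intro u f hu hlim
  have hunif : TendstoUniformly (fun n => ⇑(u n)) f atTop := by
    rw [← tendstoLocallyUniformly_iff_tendstoUniformly_of_compactSpace]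
    exact Monotone.tendstoLocallyUniformly_of_forall_tendsto (fun n => (u n).continuous)
      (fun m n h x => hu h x) f.continuous hlim
  rw [Metric.tendsto_atTop]
  intro ε hε
  obtain ⟨N, hN⟩ := eventually_atTop.1 (Metric.tendstoUniformly_iff.1 hunif (ε / 2) (half_pos hε))
  refine ⟨N, fun n hn => ?_⟩
  have hle : I (u n) ≤ I (f + const X (ε / 2)) := hmono (ContinuousMap.le_def.2 fun x => by
    have := hN n hn x
    rw [Real.dist_eq, abs_lt] at this
    simp only [ContinuousMap.add_apply, const_apply]
    linarith)
  have hge : I f ≤ I (u n + const X (ε / 2)) := hmono (ContinuousMap.le_def.2 fun x => by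
    have := hN n hn x
    rw [Real.dist_eq, abs_lt] at this
    simp only [ContinuousMap.add_apply, const_apply]
    linarith)
  rw [hadd.map_add_const hmono hone] at hle hge
  rw [Real.dist_eq, abs_lt]
  constructor <;> linarith

/-! ### The inner capacity and its lower continuity -/

/-- The inner approximation of a set by continuous functions with values in `[0, 1]`. -/
def innerFunctions (A : Set X) : Set C(X, ℝ) :=
  {g | (∀ x, 0 ≤ g x) ∧ (∀ x, g x ≤ 1) ∧ ∀ x, x ∉ A → g x = 0}

theorem zero_mem_innerFunctions (A : Set X) : (0 : C(X, ℝ)) ∈ innerFunctions A :=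
  ⟨fun _ => le_rfl, fun _ => zero_le_one, fun _ _ => rfl⟩

theorem innerFunctions_mono {A B : Set X} (h : A ⊆ B) : innerFunctions A ⊆ innerFunctions B :=
  fun _ hg => ⟨hg.1, hg.2.1, fun x hx => hg.2.2 x fun hA => hx (h hA)⟩

theorem bddAbove_image_innerFunctions (hmono : Monotone I) (A : Set X) :
    BddAbove (I '' innerFunctions A) :=
  ⟨I 1, by rintro _ ⟨g, hg, rfl⟩; exact hmono hg.2.1⟩

theorem le_sSup_innerFunctions (hmono : Monotone I) {A : Set X} {g : C(X, ℝ)}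
    (hg : g ∈ innerFunctions A) : I g ≤ sSup (I '' innerFunctions A) :=
  le_csSup (bddAbove_image_innerFunctions hmono A) ⟨g, hg, rfl⟩

theorem sSup_innerFunctions_le {A : Set X} {c : ℝ} (h : ∀ g ∈ innerFunctions A, I g ≤ c) :
    sSup (I '' innerFunctions A) ≤ c :=
  csSup_le ⟨_, 0, zero_mem_innerFunctions A, rfl⟩ (by rintro _ ⟨g, hg, rfl⟩; exact h g hg)

/-- The capacity `A ↦ sup {I g | 0 ≤ g ≤ 1_A}`. -/
noncomputable def innerCapacity (I : C(X, ℝ) → ℝ) (hadd : ComonotoneAdditive I)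
    (hmono : Monotone I) : Capacity (upperContourOpen X) where
  toFun A := sSup (I '' innerFunctions (A : Set X))
  nonneg A := hadd.map_zero ▸ le_sSup_innerFunctions hmono (zero_mem_innerFunctions (A : Set X))
  empty := by
    refine le_antisymm (sSup_innerFunctions_le fun g hg => ?_)
      (hadd.map_zero ▸ le_sSup_innerFunctions hmono (zero_mem_innerFunctions ∅))
    have : g = 0 := by ext x; exact hg.2.2 x (Set.notMem_empty x)
    rw [this, hadd.map_zero]
  mono _ _ h := sSup_innerFunctions_le fun _ hg =>
    le_sSup_innerFunctions hmono (innerFunctions_mono h hg)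

theorem innerCapacity_isNormalized (hadd : ComonotoneAdditive I) (hmono : Monotone I)
    (hone : I 1 = 1) : (innerCapacity I hadd hmono).IsNormalized := by
  refine le_antisymm (sSup_innerFunctions_le fun g hg => ?_) ?_
  · exact hone ▸ hmono hg.2.1
  · exact hone ▸ le_sSup_innerFunctions hmono
      ⟨fun _ => zero_le_one, fun _ => le_rfl, fun x hx => absurd (Set.mem_univ x) hx⟩

theorem isOpen_of_mem_upperContourOpen {A : Set X} (hA : A ∈ (upperContourOpen X).carrier) :
    IsOpen A := by
  obtain ⟨f, t, rfl⟩ := hA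
  exact isOpen_lt continuous_const f.continuous

theorem innerCapacity_isLowerContinuous [CompactSpace X] (hadd : ComonotoneAdditive I)
    (hmono : Monotone I) (hone : I 1 = 1) : (innerCapacity I hadd hmono).IsLowerContinuous := by
  intro A hA hU
  set μ := innerCapacity I hadd hmono
  have hle : ∀ n, μ.toFun (A n) ≤ μ.toFun ⟨⋃ n, (A n : Set X), hU⟩ := fun n =>
    μ.mono _ _ (Set.subset_iUnion (fun n => (A n : Set X)) n)
  have hmn : Monotone fun n => μ.toFun (A n) := fun m n h => μ.mono _ _ (hA m n h)
  refine tendsto_atTop_isLUB hmn ⟨?_, fun c hc => ?_⟩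
  · rintro _ ⟨n, rfl⟩
    exact hle n
  refine sSup_innerFunctions_le fun g hg => le_of_forall_pos_le_add fun ε hε => ?_
  -- By compactness a single A_n contains {g ≥ ε}; then (g - ε)⁺ is admissible for A_n, and passing
  -- to it costs at most ε.
  have hK : IsCompact {x | ε ≤ g x} := (isClosed_le continuous_const g.continuous).isCompact
  obtain ⟨n, hn⟩ := hK.elim_directed_cover (fun n => (A n : Set X))
    (fun n => isOpen_of_mem_upperContourOpen (A n).2)
    (fun x hx => by
      by_contra hx'
      have h0 : ε ≤ g x := hx
      rw [hg.2.2 x hx'] at h0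
      linarith)
    (directed_of_isDirected_le fun m n h => hA m n h)
  have hmem : ((g - const X ε) ⊔ 0) ∈ innerFunctions (A n : Set X) := by
    refine ⟨fun x => ?_, fun x => ?_, fun x hx => ?_⟩
    · simp
    · have := hg.2.1 x
      simp only [sup_apply, ContinuousMap.sub_apply, const_apply, ContinuousMap.zero_apply]
      exact max_le (by linarith) zero_le_one
    · have : g x < ε := not_le.1 fun h => hx (hn h)
      simp only [sup_apply, ContinuousMap.sub_apply, const_apply, ContinuousMap.zero_apply]
      exact max_eq_right (by linarith)
  have h1 := le_sSup_innerFunctions hmono hmem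
  have h2 : I g ≤ I (((g - const X ε) ⊔ 0) + const X ε) := hmono (ContinuousMap.le_def.2 fun x => by
    simp only [sup_apply, ContinuousMap.sub_apply, const_apply, ContinuousMap.zero_apply, ContinuousMap.add_apply]
    linarith [le_max_left (g x - ε) 0])
  rw [hadd.map_add_const hmono hone] at h2
  have h3 : sSup (I '' innerFunctions (A n : Set X)) ≤ c := hc ⟨n, rfl⟩
  linarith

/-! ### The Choquet formula -/

theorem ComonotoneAdditive.map_inf_const_sub (hadd : ComonotoneAdditive I) (hmono : Monotone I)
    (f : C(X, ℝ)) {s t : ℝ} (hst : s < t) :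
    I (f ⊓ const X t) - I (f ⊓ const X s) = (t - s) * I (clip f s (t - s)⁻¹) := by
  have hts : 0 < t - s := sub_pos.2 hst
  have e : f ⊓ const X t = f ⊓ const X s + (t - s) • clip f s (t - s)⁻¹ := by
    ext x
    simp only [inf_apply, const_apply, ContinuousMap.add_apply, ContinuousMap.smul_apply, smul_eq_mul, clip_apply]
    rw [mul_min_of_nonneg _ _ hts.le, mul_max_of_nonneg _ _ hts.le,
      mul_inv_cancel_left₀ hts.ne', mul_zero, mul_one]
    rcases le_total (f x) s with h1 | h1
    · rw [min_eq_left (h1.trans hst.le), min_eq_left h1, max_eq_right (by linarith),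
        min_eq_left hts.le, add_zero]
    · rw [min_eq_right h1, max_eq_left (by linarith)]
      rcases le_total (f x) t with h2 | h2
      · rw [min_eq_left h2, min_eq_left (by linarith)]; ring
      · rw [min_eq_right h2, min_eq_right (by linarith)]; ring
  have hco : Comonotone (f ⊓ const X s) ((t - s) • clip f s (t - s)⁻¹) := by
    refine comonotone_of_monotone_comp f _ _ (φ := fun y => min y s)
      (ψ := fun y => (t - s) * min (max ((t - s)⁻¹ * (y - s)) 0) 1)
      (fun a b h => min_le_min_right _ h) (fun a b h => ?_) (fun _ => rfl) fun x => ?_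
    · have : 0 ≤ (t - s)⁻¹ := inv_nonneg.2 hts.le
      dsimp only
      gcongr
    · rw [ContinuousMap.smul_apply, clip_apply, smul_eq_mul]
  rw [e, hadd _ _ hco, hadd.map_smul hmono (fun x => clip_nonneg f s _ x) hts.le]
  ring

theorem clip_mem_innerFunctions (f : C(X, ℝ)) (s : ℝ) {c : ℝ} (hc : 0 ≤ c) :
    clip f s c ∈ innerFunctions (contour f s : Set X) := by
  refine ⟨clip_nonneg f s c, clip_le_one f s c, fun x hx => ?_⟩
  have hx' : f x ≤ s := not_lt.1 hx
  rw [clip_apply, max_eq_right (mul_nonpos_of_nonneg_of_nonpos hc (by linarith)),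
    min_eq_left zero_le_one]

theorem le_clip_of_mem_innerFunctions {f g : C(X, ℝ)} {s t : ℝ} (hst : s < t)
    (hg : g ∈ innerFunctions (contour f t : Set X)) : g ≤ clip f s (t - s)⁻¹ := by
  refine ContinuousMap.le_def.2 fun x => ?_
  by_cases hx : x ∈ (contour f t : Set X)
  · have hx' : t < f x := hx
    have h1 : 1 ≤ (t - s)⁻¹ * (f x - s) := by
      rw [inv_mul_eq_div, one_le_div (sub_pos.2 hst)]
      linarith
    have e : clip f s (t - s)⁻¹ x = 1 := by
      rw [clip_apply]
      exact min_eq_right (h1.trans (le_max_left _ _))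
    rw [e]
    exact hg.2.1 x
  · rw [hg.2.2 x hx]
    exact clip_nonneg _ _ _ _

theorem Capacity.antitone_contour (μ : Capacity (upperContourOpen X)) (f : C(X, ℝ)) :
    Antitone fun t => μ.toFun (contour f t) :=
  fun _ _ hst => μ.mono _ _ fun _ hx => lt_of_le_of_lt hst hx

theorem contour_eq_empty {f : C(X, ℝ)} {t : ℝ} (h : ∀ x, f x ≤ t) :
    contour f t = ⟨∅, (upperContourOpen X).empty_mem⟩ :=
  Subtype.ext (Set.eq_empty_of_forall_notMem fun x hx => absurd hx (not_lt.2 (h x)))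

theorem contour_eq_univ {f : C(X, ℝ)} {t : ℝ} (h : ∀ x, t < f x) :
    contour f t = ⟨Set.univ, (upperContourOpen X).univ_mem⟩ :=
  Subtype.ext (Set.eq_univ_of_forall h)

theorem innerCapacity_represents [CompactSpace X] (hadd : ComonotoneAdditive I)
    (hmono : Monotone I) (hone : I 1 = 1) : Represents (innerCapacity I hadd hmono) I := by
  intro f
  set μ := innerCapacity I hadd hmono with hμ
  set m : ℝ → ℝ := fun t => μ.toFun (contour f t) with hm_def
  have hm : Antitone m := μ.antitone_contour f
  -- The bound is strict so that the strict contour at level -M is already all of X.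
  obtain ⟨M, hM0, hM⟩ : ∃ M : ℝ, 0 < M ∧ ∀ x, |f x| < M :=
    ⟨‖f‖ + 1, by positivity, fun x => (f.norm_coe_le_norm x).trans_lt (lt_add_one _)⟩
  have hzero : ∀ t, M ≤ t → m t = 0 := fun t ht => by
    rw [hm_def]
    dsimp only
    rw [contour_eq_empty fun x => (le_abs_self _).trans ((hM x).le.trans ht)]
    exact μ.empty
  have hone' : ∀ t, t ≤ -M → m t = 1 := fun t ht => by
    rw [hm_def]
    dsimp only
    rw [contour_eq_univ fun x => ht.trans_lt (abs_lt.1 (hM x)).1]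
    exact innerCapacity_isNormalized hadd hmono hone
  have hF : I (f ⊓ const X M) - I (f ⊓ const X (-M)) = ∫ t in (-M)..M, m t := by
    refine sub_eq_integral_of_antitone (F := fun t => I (f ⊓ const X t)) hm ?_ ?_ (by linarith)
    · intro s t hst
      rw [hadd.map_inf_const_sub hmono f hst]
      exact mul_le_mul_of_nonneg_left (sSup_innerFunctions_le fun g hg =>
        hmono (le_clip_of_mem_innerFunctions hst hg)) (sub_pos.2 hst).le
    · intro s t hst
      rw [hadd.map_inf_const_sub hmono f hst]
      exact mul_le_mul_of_nonneg_left (le_sSup_innerFunctions hmono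
        (clip_mem_innerFunctions f s (inv_nonneg.2 (sub_pos.2 hst).le))) (sub_pos.2 hst).le
  have e1 : f ⊓ const X M = f := by
    ext x; exact min_eq_left (abs_lt.1 (hM x)).2.le
  have e2 : f ⊓ const X (-M) = const X (-M) := by
    ext x; exact min_eq_right (abs_lt.1 (hM x)).1.le
  rw [e1, e2, hadd.map_const hmono hone] at hF
  have hint : ∀ a b, IntervalIntegrable m volume a b := fun a b => hm.intervalIntegrable
  have i1 : IntegrableOn m (Set.Ioc 0 M) := (intervalIntegrable_iff_integrableOn_Ioc_of_le
    hM0.le).1 (hint 0 M)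
  have i2 : IntegrableOn (fun t => m t - 1) (Set.Ioc (-M) 0) :=
    (intervalIntegrable_iff_integrableOn_Ioc_of_le (by linarith)).1
      ((hint (-M) 0).sub intervalIntegrable_const)
  have z1 : ∀ t ∈ Set.Ioi (0 : ℝ) \ Set.Ioc 0 M, m t = 0 := fun t ht =>
    hzero t (not_lt.1 fun h => ht.2 ⟨ht.1, h.le⟩)
  have z2 : ∀ t ∈ Set.Iic (0 : ℝ) \ Set.Ioc (-M) 0, m t - 1 = 0 := fun t ht =>
    sub_eq_zero.2 (hone' t (not_lt.1 fun h => ht.2 ⟨h, ht.1⟩))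
  refine ⟨i1.of_forall_sdiff_eq_zero measurableSet_Ioi z1,
    i2.of_forall_sdiff_eq_zero measurableSet_Iic z2, ?_⟩
  rw [setIntegral_eq_of_subset_of_forall_sdiff_eq_zero measurableSet_Ioi
      Set.Ioc_subset_Ioi_self z1,
    setIntegral_eq_of_subset_of_forall_sdiff_eq_zero measurableSet_Iic
      Set.Ioc_subset_Iic_self z2, ← intervalIntegral.integral_of_le hM0.le,
    ← intervalIntegral.integral_of_le (by linarith : -M ≤ 0),
    intervalIntegral.integral_sub (hint _ _) intervalIntegrable_const,
    intervalIntegral.integral_const]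
  rw [← intervalIntegral.integral_add_adjacent_intervals (hint (-M) 0) (hint 0 M)] at hF
  simp only [smul_eq_mul]
  linarith

/-! ### Recovering the capacity from the functional -/

/-- The slice h takes values in [0, 1], so I(h) is the integral of μ(h > s) over 0 < s < 1, where {f
> t + 1/c} ⊆ {h > s} ⊆ {f > t}. -/
theorem Represents.map_clip_mem_Icc {μ : Capacity (upperContourOpen X)} (hμ : μ.IsNormalized)
    (hI : Represents μ I) (f : C(X, ℝ)) (t : ℝ) {c : ℝ} (hc : 0 < c) :
    I (clip f t c) ∈ Set.Icc (μ.toFun (contour f (t + c⁻¹))) (μ.toFun (contour f t)) := by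
  obtain ⟨h1, -, h3⟩ := hI (clip f t c)
  have hneg : ∫ s in Set.Iic (0 : ℝ), (μ.toFun (contour (clip f t c) s) - 1) = 0 := by
    -- At level 0 the contour of the slice need not be X; this null endpoint is dropped.
    rw [integral_Iic_eq_integral_Iio]
    refine setIntegral_eq_zero_of_forall_eq_zero fun s hs => ?_
    rw [contour_eq_univ fun x => lt_of_lt_of_le hs (clip_nonneg f t c x), sub_eq_zero]
    exact hμ
  rw [hneg, add_zero] at h3
  have hcut : ∫ s in Set.Ioi (0 : ℝ), μ.toFun (contour (clip f t c) s)
      = ∫ s in Set.Ioo (0 : ℝ) 1, μ.toFun (contour (clip f t c) s) := by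
    refine setIntegral_eq_of_subset_of_forall_sdiff_eq_zero measurableSet_Ioi
      (fun s hs => hs.1) fun s hs => ?_
    rw [contour_eq_empty fun x => (clip_le_one f t c x).trans
      (not_lt.1 fun h => hs.2 ⟨hs.1, h⟩)]
    exact μ.empty
  rw [hcut] at h3
  have hint : IntegrableOn (fun s => μ.toFun (contour (clip f t c) s)) (Set.Ioo (0 : ℝ) 1) :=
    h1.mono_set fun s hs => hs.1
  have hconst : ∀ r : ℝ, IntegrableOn (fun _ : ℝ => r) (Set.Ioo (0 : ℝ) 1) := fun r =>
    integrableOn_const (by simp)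
  have hval : ∀ r : ℝ, ∫ _ in Set.Ioo (0 : ℝ) 1, r = r := fun r => by simp
  rw [h3]
  constructor
  · rw [← hval (μ.toFun (contour f (t + c⁻¹)))]
    refine setIntegral_mono_on (hconst _) hint measurableSet_Ioo fun s hs => μ.mono _ _ ?_
    intro x hx
    have hx' : t + c⁻¹ < f x := hx
    have : 1 ≤ c * (f x - t) := by
      rw [← mul_inv_cancel₀ hc.ne']
      exact mul_le_mul_of_nonneg_left (by linarith) hc.le
    change s < clip f t c x
    rw [clip_apply, min_eq_right (this.trans (le_max_left _ _))]
    exact hs.2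
  · rw [← hval (μ.toFun (contour f t))]
    refine setIntegral_mono_on hint (hconst _) measurableSet_Ioo fun s hs => μ.mono _ _ ?_
    intro x hx
    by_contra hx'
    have h0 := (clip_mem_innerFunctions f t hc.le).2.2 x hx'
    have : s < clip f t c x := hx
    rw [h0] at this
    exact absurd hs.1 (not_lt.2 this.le)

theorem Capacity.IsLowerContinuous.tendsto_contour {μ : Capacity (upperContourOpen X)}
    (hμ : μ.IsLowerContinuous) (f : C(X, ℝ)) (t : ℝ) :
    Tendsto (fun n : ℕ => μ.toFun (contour f (t + ((n : ℝ) + 1)⁻¹))) atTop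
      (𝓝 (μ.toFun (contour f t))) := by
  have hU : (⋃ n : ℕ, (contour f (t + ((n : ℝ) + 1)⁻¹) : Set X)) = contour f t := by
    ext x
    simp only [Set.mem_iUnion]
    constructor
    · rintro ⟨n, hn⟩
      have hn' : t + ((n : ℝ) + 1)⁻¹ < f x := hn
      have : (0 : ℝ) < ((n : ℝ) + 1)⁻¹ := by positivity
      change t < f x
      linarith
    · intro hx
      have hx' : t < f x := hx
      obtain ⟨n, hn⟩ := exists_nat_one_div_lt (sub_pos.2 hx')
      rw [one_div] at hn
      exact ⟨n, show t + ((n : ℝ) + 1)⁻¹ < f x by linarith⟩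
  have h := hμ (fun n => contour f (t + ((n : ℝ) + 1)⁻¹)) (fun m n hmn x hx => ?_)
    (hU ▸ (contour f t).2)
  · convert h using 3
    exact Subtype.ext hU.symm
  · have hx' : t + ((m : ℝ) + 1)⁻¹ < f x := hx
    have : ((n : ℝ) + 1)⁻¹ ≤ ((m : ℝ) + 1)⁻¹ := by gcongr
    change t + ((n : ℝ) + 1)⁻¹ < f x
    linarith

theorem Represents.tendsto_map_clip {μ : Capacity (upperContourOpen X)}
    (hlc : μ.IsLowerContinuous) (hμ : μ.IsNormalized) (hI : Represents μ I) (f : C(X, ℝ))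
    (t : ℝ) :
    Tendsto (fun n : ℕ => I (clip f t ((n : ℝ) + 1))) atTop (𝓝 (μ.toFun (contour f t))) :=
  tendsto_of_tendsto_of_tendsto_of_le_of_le (hlc.tendsto_contour f t) tendsto_const_nhds
    (fun _ => (hI.map_clip_mem_Icc hμ f t (by positivity)).1)
    fun _ => (hI.map_clip_mem_Icc hμ f t (by positivity)).2

/-- A common level 0 makes unions and intersections the contours of `f ⊔ g` and `f ⊓ g`. -/
theorem exists_eq_contour_zero (A : {A : Set X // A ∈ (upperContourOpen X).carrier}) :
    ∃ f : C(X, ℝ), A = contour f 0 := by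
  obtain ⟨_, f, t, rfl⟩ := A
  exact ⟨f - const X t, Subtype.ext (by ext x; simp [contour])⟩

theorem Represents.capacity_ext {μ ν : Capacity (upperContourOpen X)}
    (hμc : μ.IsLowerContinuous) (hμn : μ.IsNormalized) (hμ : Represents μ I)
    (hνc : ν.IsLowerContinuous) (hνn : ν.IsNormalized) (hν : Represents ν I) : μ = ν := by
  ext A
  obtain ⟨f, rfl⟩ := exists_eq_contour_zero A
  exact tendsto_nhds_unique (hμ.tendsto_map_clip hμc hμn f 0) (hν.tendsto_map_clip hνc hνn f 0)

theorem Represents.isSubmodular {μ : Capacity (upperContourOpen X)}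
    (hlc : μ.IsLowerContinuous) (hμ : μ.IsNormalized) (hI : Represents μ I)
    (hsub : SubmodularFunctional I) : μ.IsSubmodular := by
  intro A B
  obtain ⟨f, rfl⟩ := exists_eq_contour_zero A
  obtain ⟨g, rfl⟩ := exists_eq_contour_zero B
  have hlim := hI.tendsto_map_clip hlc hμ
  have hunion : contour (f ⊔ g) 0 = ⟨_, (upperContourOpen X).union_mem _ (contour f 0).2 _
      (contour g 0).2⟩ := Subtype.ext (by ext x; simp [contour])
  have hinter : contour (f ⊓ g) 0 = ⟨_, (upperContourOpen X).inter_mem _ (contour f 0).2 _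
      (contour g 0).2⟩ := Subtype.ext (by ext x; simp [contour])
  rw [← hunion, ← hinter]
  refine le_of_tendsto_of_tendsto' ((hlim (f ⊔ g) 0).add (hlim (f ⊓ g) 0))
    ((hlim f 0).add (hlim g 0)) fun n => ?_
  -- Slicing at a common level is composition with a nondecreasing function, so it preserves sup and
  -- inf, and submodularity of `I` applies to the slices themselves.
  rw [clip_sup f g (by positivity), clip_inf f g (by positivity)]
  exact hsub _ _

theorem Capacity.IsNormalized.mem_Icc {μ : Capacity (upperContourOpen X)} (hμ : μ.IsNormalized)
    (A : {A : Set X // A ∈ (upperContourOpen X).carrier}) : μ.toFun A ∈ Set.Icc (0 : ℝ) 1 :=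
  ⟨μ.nonneg A, (μ.mono A ⟨Set.univ, (upperContourOpen X).univ_mem⟩ (Set.subset_univ _)).trans
    hμ.le⟩

end Functional

end ChoquetRep

theorem theorem2 {X : Type*} [TopologicalSpace X] [CompactSpace X] [T2Space X]
    (I : C(X, ℝ) → ℝ) (hadd : ChoquetRep.ComonotoneAdditive I) (hmono : Monotone I)
    (hone : I 1 = 1) :
    ChoquetRep.LowerContinuousFunctional I ∧
    (∃! μ : ChoquetRep.Capacity (ChoquetRep.upperContourOpen X),
      μ.IsLowerContinuous ∧ μ.IsNormalized ∧ ChoquetRep.Represents μ I) ∧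
    (∀ μ : ChoquetRep.Capacity (ChoquetRep.upperContourOpen X),
      μ.IsLowerContinuous → μ.IsNormalized → ChoquetRep.Represents μ I →
        (∀ A, μ.toFun A ∈ Set.Icc (0 : ℝ) 1) ∧
        (ChoquetRep.SubmodularFunctional I → μ.IsSubmodular)) := by
  have hc := ChoquetRep.innerCapacity_isLowerContinuous hadd hmono hone
  have hn := ChoquetRep.innerCapacity_isNormalized hadd hmono hone
  have hr := ChoquetRep.innerCapacity_represents hadd hmono hone
  exact ⟨hadd.lowerContinuous hmono hone,
    ⟨_, ⟨hc, hn, hr⟩, fun ν hν => hν.2.2.capacity_ext hν.1 hν.2.1 hc hn hr⟩,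
    fun μ h1 h2 h3 => ⟨h2.mem_Icc, h3.isSubmodular h1 h2⟩⟩
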